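/- Fix an optimal programming language (a partial computable map taking a binary program and a binary condition to a binary string, which describes strings at least as concisely as any other such map, up to an additive constant) and a computable injective encoding $\langle\cdot,\cdot\rangle$ of pairs of binary strings by binary strings. Let $C(x\mid z)$ be the length of a shortest program that outputs $x$ given $z$, let $C(x)$ be $C(x\mid z)$ with $z$ the empty string, and write $C(x,y)=C(\langle x,y\rangle)$ and $C(x,y\mid z)=C(\langle x,y\rangle\mid z)$. There are constants $K,c>0$ such that the following holds. (1) For every $\varepsilon>0$ and all sufficiently large $n$ there is a pair of strings $(x,y)$ such that $$|C(x)-2n|\le c\log n,\qquad |C(y)-2n|\le c\log n,\qquad |C(x,y)-3n|\le c\log n,$$ and for every string $z$ with $C(x\mid z)<(1+\varepsilon)n$ and $C(y\mid z)<(1+\varepsilon)n$ we have $$C(x,y\mid z)\le (1+K\varepsilon)n+c\log n .$$ (2) There are pairs $(x_n,y_n)$ which, for all large $n$, are as in (1) with parameters $\varepsilon_n>0$, $\varepsilon_n\to 0$, such that the triples $(a_n,b_n,c_n)=(x_n,y_n,\langle x_n,y_n\rangle)$ have the following properties. Each of $C(a_n),C(b_n),C(c_n)$ is $\Theta(n)$,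 and $\tfrac12C(c_n)=\tfrac32n+O(\log n)$. For every constant $\kappa$ and all sufficiently large $n$ there is no string $z$ satisfying all three of $$\left|C(a_n\mid z)-\tfrac12C(a_n)\right|\le\kappa\log n,\quad \left|C(b_n\mid z)-\tfrac12C(b_n)\right|\le\kappa\log n,\quad \left|C(c_n\mid z)-\tfrac12C(c_n)\right|\le\kappa\log n .$$ More precisely, for every constant $\kappa$ there is a function $g(n)=o(n)$ (so that $\tfrac32n-(n+g(n))=\Omega(n)$) such that, for all sufficiently large $n$, every string $z$ that satisfies the first two of these inequalities has $C(c_n\mid z)\le n+g(n)$. -/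

import Mathlib

open Filter Asymptotics

/-- A description mode (a programming language): a binary program `p` and a binary condition `z`
are mapped to an output string, if the computation terminates. -/
abbrev DescriptionMode : Type := List Bool → List Bool →. List Bool

/-- An optimal programming language: a partial computable description mode `D` that describes
strings as concisely as any other one, up to an additive constant. -/
def DescriptionMode.IsOptimal (D : DescriptionMode) : Prop :=
  Partrec₂ D ∧ ∀ D' : DescriptionMode, Partrec₂ D' →
    ∃ c : ℕ, ∀ p z x : List Bool, x ∈ D' p z →
      ∃ q : List Bool, q.length ≤ p.length + c ∧ x ∈ D q z

/-- Conditional Kolmogorov complexity `C(x | z)`: the length of a shortest program that outputs `x`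
given `z`. -/
noncomputable def condComplexity (D : DescriptionMode) (x z : List Bool) : ℕ :=
  sInf {k : ℕ | ∃ p : List Bool, p.length = k ∧ x ∈ D p z}

/-- Plain Kolmogorov complexity `C(x)`: the condition is the empty string. -/
noncomputable def plainComplexity (D : DescriptionMode) (x : List Bool) : ℕ :=
  condComplexity D x []

/-- A computable encoding of pairs of strings by strings. -/
def IsPairing (pr : List Bool → List Bool → List Bool) : Prop :=
  Computable₂ pr ∧ Function.Injective2 pr

/-- The pair `(x, y)` has complexity profile `(2n, 2n, 3n)` up to `c log n`, and every `z` with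
`C(x|z), C(y|z) < (1 + ε) n` has `C(x,y|z) ≤ (1 + K ε) n + c log n`. -/
def IsNonExtractable (D : DescriptionMode) (pr : List Bool → List Bool → List Bool)
    (K c ε : ℝ) (n : ℕ) (x y : List Bool) : Prop :=
  |(plainComplexity D x : ℝ) - 2 * n| ≤ c * Real.log n ∧
  |(plainComplexity D y : ℝ) - 2 * n| ≤ c * Real.log n ∧
  |(plainComplexity D (pr x y) : ℝ) - 3 * n| ≤ c * Real.log n ∧
  ∀ z : List Bool,
    (condComplexity D x z : ℝ) < (1 + ε) * n →
    (condComplexity D y z : ℝ) < (1 + ε) * n →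
    (condComplexity D (pr x y) z : ℝ) ≤ (1 + K * ε) * n + c * Real.log n

/-- Given `z`, the complexity of `x` is half of its plain complexity, up to an error `r`. -/
def Halves (D : DescriptionMode) (x z : List Bool) (r : ℝ) : Prop :=
  |(condComplexity D x z : ℝ) - (1 / 2) * plainComplexity D x| ≤ r

/-- Reads `1^k 0 q` as `(k, q)`. -/
def splitProgram : List Bool → ℕ × List Bool
  | [] => (0, [])
  | b :: l => bif b then ((splitProgram l).1 + 1, (splitProgram l).2) else (0, l)

theorem splitProgram_append (k : ℕ) (q : List Bool) :
    splitProgram (List.replicate k true ++ false :: q) = (k, q) := by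
  induction k with
  | zero => simp [splitProgram]
  | succ k ih => simp [List.replicate_succ, splitProgram, ih]

theorem splitProgram_primrec : Primrec splitProgram := by
  have h : Primrec₂ (fun (_ : List Bool) (t : Bool × List Bool × (ℕ × List Bool)) =>
      bif t.1 then (t.2.2.1 + 1, t.2.2.2) else (0, t.2.1)) := by
    have t1 : Primrec (fun a : List Bool × (Bool × List Bool × (ℕ × List Bool)) => a.2) :=
      Primrec.snd
    have t2 := Primrec.snd.comp t1
    have t3 := Primrec.snd.comp t2
    exact Primrec.cond (Primrec.fst.comp t1)
      (Primrec.pair (Primrec.succ.comp (Primrec.fst.comp t3)) (Primrec.snd.comp t3))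
      (Primrec.pair (Primrec.const 0) (Primrec.fst.comp t2))
  refine (Primrec.list_rec (f := fun l : List Bool => l) (g := fun _ => ((0 : ℕ), ([] : List Bool)))
    Primrec.id (Primrec.const _) h).of_eq fun l => ?_
  induction l with
  | nil => rfl
  | cons b l ih => cases b <;> simp_all [splitProgram]

/-- Optimal programming languages exist. -/
theorem DescriptionMode.exists_isOptimal : ∃ D : DescriptionMode, D.IsOptimal := by
  let U : DescriptionMode := fun p z =>
    ((Denumerable.ofNat Nat.Partrec.Code (splitProgram p).1).eval
      (Encodable.encode ((splitProgram p).2, z))).bind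
        fun m => ((Encodable.decode m : Option (List Bool)) : Part (List Bool))
  have hs : Computable (fun a : List Bool × List Bool => splitProgram a.1) :=
    splitProgram_primrec.to_comp.comp Computable.fst
  refine ⟨U, ?_, ?_⟩
  · refine Partrec.bind
      (Nat.Partrec.Code.eval_part.comp
        ((Computable.ofNat Nat.Partrec.Code).comp (Computable.fst.comp hs))
        (Computable.encode.comp (Computable.pair (Computable.snd.comp hs) Computable.snd))) ?_
    exact (Computable.ofOption (Computable.decode.comp Computable.snd))
  · intro D' hD'
    obtain ⟨code, hcode⟩ := Nat.Partrec.Code.exists_code.1 hD'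
    refine ⟨Encodable.encode code + 1, fun p z x hx =>
      ⟨List.replicate (Encodable.encode code) true ++ false :: p, by simp; omega, ?_⟩⟩
    simp only [U, splitProgram_append, Denumerable.ofNat_encode, hcode]
    simpa using hx

/-! The pair is an edge of a pseudorandom bipartite multigraph with `2^(2n)` vertices on each side
and `2^(3n)` edges. Edge `e` has left end `e / 2^n`, so left degrees are `2^n`, and its right end is
`f n e`. For random right ends, any vertex sets `A`, `B` span at most about `2|A||B|/2^n + 2n(|A| +
|B|)` edges (`exists_pseudorandom`, `exists_isMixing`). Exhaustive search makes such a graph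
computable from `n` (`exists_computable_isMixing`), so it costs only `O(log n)` bits in any
description.

A counting argument yields an edge whose ends have complexity near `2n` and whose pair has
complexity near `3n` (`exists_complex_edge`). Given `z`, fewer than about `2^h` vertices on each
side have complexity at most `h`. By mixing they span `O(2^(2h-n) + n 2^h)` edges
(`card_simpleEdges_le`). These edges can be enumerated from `z`, `n`, `h`, so each is described by
its index (`condComplexity_simpleEdge_le`). For `h < (1+ε)n` the index has `(1+2ε)n + O(log n)`
bits, whence `K = 2`.

The edge is chosen before `ε`, so `ε` may shrink with `n`. With `ε = 1/√(n+1)`, halving both ends up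
to `O(log n)` satisfies the hypothesis and leaves `n + o(n)` bits of the pair, whereas halving the
pair would need about `3n/2`. -/

section Combinatorics

open Finset

/-! ### Random maps with few edges between any two vertex sets -/

/-- An exponential moment argument: the moment of the edge count, normalised and weighted by
`N^(-|A|-|B|)`, is summed over all `A`, `B` at once. Its average over `f` is at most `e^2 < 8`, so
some `f` keeps every term below 8. -/
theorem exists_pseudorandom {ι V : Type*} [Fintype ι] [DecidableEq ι] [Fintype V] [DecidableEq V]
    [Nonempty V] (x : ι → V) :
    ∃ f : ι → V, ∀ A B : Finset V,
      (2 : ℝ) ^ #{e | x e ∈ A ∧ f e ∈ B} ≤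
        8 * (1 + (#B : ℝ) / Fintype.card V) ^ #{e | x e ∈ A} *
          (Fintype.card V : ℝ) ^ (#A + #B) := by
  set N : ℝ := (Fintype.card V : ℝ) with hN
  have hN0 : 0 < N := by rw [hN]; exact_mod_cast Fintype.card_pos
  -- The values `f e` are independent and uniform, so the sum over `f` factors over the edges; those
  -- with `x e ∉ A` contribute only `N`.
  have key : ∀ A B : Finset V, ∑ f : ι → V, (2 : ℝ) ^ #{e | x e ∈ A ∧ f e ∈ B} =
      N ^ Fintype.card ι * (1 + (#B : ℝ) / N) ^ #{e | x e ∈ A} := by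
    intro A B
    have h1 : ∀ f : ι → V, (2 : ℝ) ^ #{e | x e ∈ A ∧ f e ∈ B} =
        ∏ e, (if x e ∈ A ∧ f e ∈ B then (2 : ℝ) else 1) := by
      intro f
      rw [← Finset.prod_filter, Finset.prod_const]
    have h2 : ∀ e, ∑ v : V, (if x e ∈ A ∧ v ∈ B then (2 : ℝ) else 1) =
        N * (if x e ∈ A then 1 + (#B : ℝ) / N else 1) := by
      intro e
      by_cases hA : x e ∈ A
      · simp only [hA, true_and, if_true]
        have : ∀ v : V, (if v ∈ B then (2 : ℝ) else 1) = 1 + if v ∈ B then 1 else 0 := by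
          intro v; split_ifs <;> norm_num
        simp only [this, Finset.sum_add_distrib]
        simp [← hN]
        field_simp
      · simp [hA, ← hN]
    simp only [h1]
    rw [← Fintype.prod_sum (fun e v => if x e ∈ A ∧ v ∈ B then (2 : ℝ) else 1)]
    simp only [h2, Finset.prod_mul_distrib]
    rw [← Finset.prod_filter]
    simp
  -- The sum is `(1 + 1/N)^N`.
  have hsum : ∑ A : Finset V, (N⁻¹) ^ #A ≤ Real.exp 1 := by
    have := Fintype.sum_pow_mul_eq_add_pow V (N⁻¹) (1 : ℝ)
    simp only [one_pow, mul_one] at this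
    rw [this]
    calc (N⁻¹ + 1) ^ Fintype.card V ≤ (Real.exp N⁻¹) ^ Fintype.card V :=
          pow_le_pow_left₀ (by positivity) (Real.add_one_le_exp _) _
      _ = Real.exp 1 := by
          rw [← Real.exp_nat_mul, ← hN, mul_inv_cancel₀ hN0.ne']
  by_contra! hcon
  set W : (ι → V) → Finset V → Finset V → ℝ := fun f A B =>
    (2 : ℝ) ^ #{e | x e ∈ A ∧ f e ∈ B} *
      (((1 + (#B : ℝ) / N) ^ #{e | x e ∈ A})⁻¹ * (N⁻¹ ^ #A * N⁻¹ ^ #B)) with hW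
  have hWnn : ∀ f A B, 0 ≤ W f A B := fun f A B => by positivity
  have low : ∀ f, 8 < ∑ A, ∑ B, W f A B := by
    intro f
    obtain ⟨A, B, h⟩ := hcon f
    have h3 : W f A B ≤ ∑ A, ∑ B, W f A B :=
      (Finset.single_le_sum (f := fun B => W f A B) (fun B _ => hWnn f A B)
        (Finset.mem_univ B)).trans
        (Finset.single_le_sum (f := fun A => ∑ B, W f A B)
          (fun A _ => Finset.sum_nonneg fun B _ => hWnn f A B) (Finset.mem_univ A))
    refine lt_of_lt_of_le ?_ h3
    have hp : 0 < (1 + (#B : ℝ) / N) ^ #{e | x e ∈ A} := by positivity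
    have : W f A B = (2 : ℝ) ^ #{e | x e ∈ A ∧ f e ∈ B} /
        ((1 + (#B : ℝ) / N) ^ #{e | x e ∈ A} * N ^ (#A + #B)) := by
      simp only [hW, inv_pow, pow_add]
      field_simp
    rw [this, lt_div_iff₀ (by positivity)]
    linarith
  have low' : (8 : ℝ) * N ^ Fintype.card ι < ∑ f, ∑ A, ∑ B, W f A B := by
    have := Finset.sum_lt_sum_of_nonempty (s := (Finset.univ : Finset (ι → V)))
      Finset.univ_nonempty (fun f _ => low f)
    simpa [← hN, mul_comm] using this
  have up : ∑ f, ∑ A, ∑ B, W f A B =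
      N ^ Fintype.card ι * ((∑ A : Finset V, (N⁻¹) ^ #A) * ∑ B : Finset V, (N⁻¹) ^ #B) := by
    rw [Finset.sum_comm, Finset.sum_mul_sum, Finset.mul_sum]
    refine Finset.sum_congr rfl fun A _ => ?_
    rw [Finset.sum_comm, Finset.mul_sum]
    refine Finset.sum_congr rfl fun B _ => ?_
    simp only [hW]
    rw [← Finset.sum_mul, key]
    have hp : 0 < (1 + (#B : ℝ) / N) ^ #{e | x e ∈ A} := by positivity
    field_simp
  have hexp : Real.exp 1 * Real.exp 1 < 8 := by
    have := Real.exp_one_lt_d9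
    have := Real.exp_pos 1
    nlinarith
  have h0 : (0 : ℝ) ≤ ∑ A : Finset V, (N⁻¹) ^ #A := Finset.sum_nonneg fun A _ => by positivity
  have := mul_le_mul hsum hsum h0 (Real.exp_pos 1).le
  have hNE : 0 < N ^ Fintype.card ι := by positivity
  nlinarith

/-! ### Primitive recursive tools and binary strings as numbers -/

theorem Primrec.nat_pow : Primrec₂ ((· ^ ·) : ℕ → ℕ → ℕ) :=
  Primrec₂.unpaired'.1 Nat.Primrec.pow

theorem Primrec.sum_range {α : Type*} [Primcodable α] {g : α → ℕ} {f : α → ℕ → ℕ}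
    (hg : Primrec g) (hf : Primrec₂ f) : Primrec fun a => ∑ i ∈ range (g a), f a i := by
  have h : Primrec₂ fun (a : α) (t : ℕ × ℕ) => t.2 + f a t.1 :=
    Primrec.nat_add.comp (Primrec.snd.comp Primrec.snd)
      (hf.comp Primrec.fst (Primrec.fst.comp Primrec.snd))
  refine (Primrec.nat_rec' hg (Primrec.const 0) h).of_eq fun a => ?_
  induction g a with
  | zero => rfl
  | succ k ih => simp [Finset.sum_range_succ, ← ih]

/-- The number whose binary digits, least significant first, are the given bits. -/
def bitsValue (l : List Bool) : ℕ := l.foldr (fun b m => 2 * m + bif b then 1 else 0) 0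

theorem bitsValue_primrec : Primrec bitsValue := by
  have h : Primrec₂ (fun (_ : List Bool) (t : Bool × ℕ) => 2 * t.2 + bif t.1 then 1 else 0) :=
    Primrec.nat_add.comp (Primrec.nat_mul.comp (Primrec.const 2) (Primrec.snd.comp Primrec.snd))
      (Primrec.cond (Primrec.fst.comp Primrec.snd) (Primrec.const 1) (Primrec.const 0))
  exact Primrec.list_foldr Primrec.id (Primrec.const 0) h

theorem exists_bitsValue_eq (m i : ℕ) (h : i < 2 ^ m) :
    ∃ l : List Bool, l.length = m ∧ bitsValue l = i := by
  induction m generalizing i with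
  | zero => exact ⟨[], rfl, by simp_all [bitsValue]⟩
  | succ m ih =>
    obtain ⟨l, h1, h2⟩ := ih (i / 2) (by rw [pow_succ] at h; omega)
    refine ⟨decide (i % 2 = 1) :: l, by simp [h1], ?_⟩
    have : bitsValue (decide (i % 2 = 1) :: l) =
      2 * bitsValue l + bif decide (i % 2 = 1) then 1 else 0 := rfl
    rw [this, h2]
    rcases Nat.mod_two_eq_zero_or_one i with h | h <;> simp [h] <;> omega

theorem bitsValue_append_true_lt (l : List Bool) : bitsValue (l ++ [true]) < 2 ^ (l.length + 1) := by
  induction l with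
  | nil => simp [bitsValue]
  | cons b l ih =>
    have : bitsValue (b :: l ++ [true]) = 2 * bitsValue (l ++ [true]) + bif b then 1 else 0 := rfl
    rw [this, List.length_cons, pow_succ]
    cases b <;> simp <;> omega

/-- The appended bit is the most significant one, so it marks where the string ends and trailing
zeros are not lost. -/
theorem bitsValue_append_true_injective :
    Function.Injective fun l : List Bool => bitsValue (l ++ [true]) := by
  intro l l' h
  have pos : ∀ l : List Bool, 0 < bitsValue (l ++ [true]) := by
    intro l
    induction l with
    | nil => simp [bitsValue]
    | cons b l ih =>
      have : bitsValue (b :: l ++ [true]) = 2 * bitsValue (l ++ [true]) + bif b then 1 else 0 := rfl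
      omega
  have cons : ∀ b l, bitsValue (b :: l ++ [true]) =
    2 * bitsValue (l ++ [true]) + bif b then 1 else 0 := fun _ _ => rfl
  have nil : bitsValue ([] ++ [true]) = 1 := rfl
  induction l generalizing l' with
  | nil =>
    cases l' with
    | nil => rfl
    | cons b l' =>
      simp only [cons, nil] at h
      have := pos l'
      omega
  | cons b l ih =>
    cases l' with
    | nil =>
      simp only [cons, nil] at h
      have := pos l
      omega
    | cons b' l' =>
      simp only [cons] at h
      have hb : b = b' := by
        cases b <;> cases b' <;> simp at h ⊢ <;> omega
      subst hb
      rw [ih (show bitsValue (l ++ [true]) = bitsValue (l' ++ [true]) by omega)]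

/-! ### Upper bounds on complexity and counting -/

/-- Comparison with the mode that returns its own program shows that the set of lengths is nonempty,
so the infimum is attained and is not the default 0. -/
theorem DescriptionMode.IsOptimal.exists_program {D : DescriptionMode} (hD : D.IsOptimal)
    (x z : List Bool) : ∃ p : List Bool, p.length = condComplexity D x z ∧ x ∈ D p z := by
  obtain ⟨c, hc⟩ := hD.2 (fun p _ => Part.some p) (Computable.fst (α := List Bool) (β := List Bool))
  obtain ⟨q, -, hq⟩ := hc x z x (Part.mem_some _)
  exact Nat.sInf_mem (s := {k : ℕ | ∃ p : List Bool, p.length = k ∧ x ∈ D p z}) ⟨_, q, rfl, hq⟩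

theorem condComplexity_le_length {D : DescriptionMode} {p x z : List Bool} (h : x ∈ D p z) :
    condComplexity D x z ≤ p.length :=
  Nat.sInf_le ⟨p, rfl, h⟩

/-- The program is `s` in unary, a separator, then `v + 2^s * i` in `s + m` bits. Hence the
parameter `v` costs `2s`, while the index `i` costs exactly `m`. -/
theorem DescriptionMode.IsOptimal.condComplexity_le {D : DescriptionMode} (hD : D.IsOptimal)
    {Φ : (ℕ × ℕ) × List Bool →. List Bool} (hΦ : Partrec Φ) :
    ∃ c : ℕ, ∀ v i s m x z, v < 2 ^ s → i < 2 ^ m → x ∈ Φ ((v, i), z) →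
      condComplexity D x z ≤ m + 2 * s + c := by
  let D' : DescriptionMode := fun p z =>
    Φ ((bitsValue (splitProgram p).2 % 2 ^ (splitProgram p).1,
      bitsValue (splitProgram p).2 / 2 ^ (splitProgram p).1), z)
  have hs : Primrec fun a : List Bool × List Bool => splitProgram a.1 :=
    splitProgram_primrec.comp Primrec.fst
  have hv := bitsValue_primrec.comp (Primrec.snd.comp hs)
  have hp := Primrec.nat_pow.comp (Primrec.const 2) (Primrec.fst.comp hs)
  have hD' : Partrec₂ D' := hΦ.comp (Primrec.pair (Primrec.pair (Primrec.nat_mod.comp hv hp)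
    (Primrec.nat_div.comp hv hp)) Primrec.snd).to_comp
  obtain ⟨c, hc⟩ := hD.2 D' hD'
  refine ⟨c + 1, fun v i s m x z hvs him hx => ?_⟩
  have hlt : v + 2 ^ s * i < 2 ^ (s + m) := by
    rw [pow_add]
    nlinarith
  obtain ⟨q, hq, hqv⟩ := exists_bitsValue_eq _ _ hlt
  obtain ⟨p, hp, hpx⟩ := hc (List.replicate s true ++ false :: q) z x (by
    simp only [D', splitProgram_append, hqv]
    rwa [Nat.add_mul_mod_self_left, Nat.mod_eq_of_lt hvs, Nat.add_mul_div_left _ _ (by positivity),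
      Nat.div_eq_of_lt hvs, zero_add])
  have := condComplexity_le_length hpx
  simp at hp
  omega

/-- There are at most `2 ^ (k + 1)` objects of complexity at most `k`. -/
theorem DescriptionMode.IsOptimal.card_le {D : DescriptionMode} (hD : D.IsOptimal)
    {α : Type*} {f : α → List Bool} (hf : Function.Injective f) (z : List Bool) (k : ℕ)
    (S : Finset α) (hS : ∀ a ∈ S, condComplexity D (f a) z ≤ k) : #S ≤ 2 ^ (k + 1) := by
  choose p hp hpx using fun x => hD.exists_program x z
  rw [← Finset.card_range (2 ^ (k + 1))]
  refine Finset.card_le_card_of_injOn (fun a => bitsValue (p (f a) ++ [true])) ?_ ?_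
  · intro a ha
    simp only [coe_range, Set.mem_Iio]
    refine (bitsValue_append_true_lt _).trans_le (Nat.pow_le_pow_right (by norm_num) ?_)
    rw [hp]
    have := hS a ha
    omega
  · intro a _ b _ h
    have h1 : p (f a) = p (f b) := bitsValue_append_true_injective h
    have h2 := hpx (f a)
    rw [h1] at h2
    exact hf (Part.mem_unique h2 (hpx (f b)))

/-! ### Unbounded search and enumeration -/

theorem Nat.mem_rfind_some {p : ℕ → Bool} {n : ℕ} :
    n ∈ Nat.rfind (fun t => Part.some (p t)) ↔ p n = true ∧ ∀ m < n, p m = false := by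
  refine Nat.mem_rfind.trans ⟨fun ⟨h1, h2⟩ => ⟨(Part.mem_some_iff.1 h1).symm, fun m hm =>
    (Part.mem_some_iff.1 (h2 hm)).symm⟩, fun ⟨h1, h2⟩ => ⟨Part.mem_some_iff.2 h1.symm,
    fun {m} hm => Part.mem_some_iff.2 (h2 m hm).symm⟩⟩

theorem Nat.rfind_some_dom {p : ℕ → Bool} :
    (Nat.rfind (fun t => Part.some (p t))).Dom ↔ ∃ n, p n = true := by
  rw [Part.dom_iff_mem]
  refine ⟨fun ⟨n, hn⟩ => ⟨n, (Nat.mem_rfind_some.1 hn).1⟩, fun ⟨n, hn⟩ => ?_⟩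
  obtain ⟨m, hm, -⟩ := Nat.rfind_min' hn
  exact ⟨m, hm⟩

open Nat.Partrec (Code)

/-- The elements of an enumerable family of sets can be computed from their numbers. -/
theorem exists_partrec_enumeration {α : Type*} [Primcodable α] {R : α × ℕ → ℕ → Bool}
    (hR : Computable₂ R) :
    ∃ F : α × ℕ →. ℕ, Partrec F ∧ ∀ (a : α) (T : Finset ℕ),
      (∀ e, (∃ t, R (a, e) t = true) → e ∈ T) →
        ∀ e, (∃ t, R (a, e) t = true) → ∃ i < #T, e ∈ F (a, i) := by
  have hG : Partrec fun w : α × ℕ => Nat.rfind fun t => Part.some (R w t) :=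
    Partrec.rfind hR.partrec₂
  -- `R` need not be monotone in `t`; running a code for the search with bounded fuel gives a test
  -- that is monotone and primitive recursive.
  obtain ⟨c, hc⟩ := Code.exists_code.1 hG
  let ev : α → ℕ → ℕ → Bool := fun a e s => (Code.evaln s c (Encodable.encode (a, e))).isSome
  have hev : ∀ a e, (∃ s, ev a e s = true) ↔ ∃ t, R (a, e) t = true := by
    intro a e
    have h1 : (∃ s, ev a e s = true) ↔ (c.eval (Encodable.encode (a, e))).Dom := by
      simp only [ev, Option.isSome_iff_exists, Part.dom_iff_mem, Nat.Partrec.Code.evaln_complete,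
        Option.mem_def]
      exact exists_comm
    rw [h1, hc, ← Nat.rfind_some_dom]
    simp
  have mono : ∀ a e s s', s ≤ s' → ev a e s = true → ev a e s' = true := by
    intro a e s s' hs h
    simp only [ev, Option.isSome_iff_exists] at h ⊢
    obtain ⟨y, hy⟩ := h
    exact ⟨y, Nat.Partrec.Code.evaln_mono hs hy⟩
  -- `t` codes `(e, s)` where `e` is accepted with fuel `s + 1` but not `s`, so each accepted `e`
  -- has exactly one such `t`.
  let Q : α → ℕ → Bool := fun a t => ev a t.unpair.1 (t.unpair.2 + 1) && !ev a t.unpair.1 t.unpair.2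
  have hevp : Primrec fun w : (α × ℕ) × ℕ => ev w.1.1 w.1.2 w.2 :=
    Primrec.option_isSome.comp (Code.primrec_evaln.comp (Primrec.pair
      (Primrec.pair Primrec.snd (Primrec.const c)) (Primrec.encode.comp Primrec.fst)))
  have hu1 : Primrec fun w : α × ℕ => w.2.unpair.1 :=
    Primrec.fst.comp (Primrec.unpair.comp Primrec.snd)
  have hu2 : Primrec fun w : α × ℕ => w.2.unpair.2 :=
    Primrec.snd.comp (Primrec.unpair.comp Primrec.snd)
  have hQ : Primrec₂ Q :=
    Primrec.and.comp
      (hevp.comp (Primrec.pair (Primrec.pair Primrec.fst hu1) (Primrec.succ.comp hu2)))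
      (Primrec.not.comp (hevp.comp (Primrec.pair (Primrec.pair Primrec.fst hu1) hu2)))
  let cnt : α → ℕ → ℕ := fun a t => ∑ s ∈ range t, bif Q a s then 1 else 0
  have hcnt : Primrec₂ cnt :=
    Primrec.sum_range Primrec.snd (Primrec.cond (hQ.comp (Primrec.fst.comp Primrec.fst) Primrec.snd)
      (Primrec.const 1) (Primrec.const 0))
  have cnt_mono : ∀ a, Monotone (cnt a) := fun a =>
    monotone_nat_of_le_succ fun n => by simp [cnt, Finset.sum_range_succ]
  have cnt_succ : ∀ a t, Q a t = true → cnt a (t + 1) = cnt a t + 1 := by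
    intro a t h
    simp [cnt, Finset.sum_range_succ, h]
  -- The hit preceded by exactly `w.2` hits.
  let P : α × ℕ → ℕ → Bool := fun w t => Q w.1 t && decide (cnt w.1 t = w.2)
  have hP : Primrec₂ P :=
    Primrec.and.comp (hQ.comp (Primrec.fst.comp Primrec.fst) Primrec.snd)
      (Primrec.eq.decide.comp (hcnt.comp (Primrec.fst.comp Primrec.fst) Primrec.snd)
        (Primrec.snd.comp Primrec.fst))
  refine ⟨fun w => (Nat.rfind fun t => Part.some (P w t)).map fun t => t.unpair.1, ?_, ?_⟩
  · exact (Partrec.rfind hP.to_comp.partrec₂).map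
      (Computable.fst.comp (Computable.unpair.comp Computable.snd)).to₂
  intro a T hT e he
  obtain ⟨s, hs0, hs1⟩ : ∃ s, ev a e (s + 1) = true ∧ ev a e s = false := by
    classical
    have hex := (hev a e).2 he
    have h0 : Nat.find hex ≠ 0 := by
      intro h
      have := Nat.find_spec hex
      rw [h] at this
      simp [ev, Nat.Partrec.Code.evaln] at this
    obtain ⟨s, hs⟩ := Nat.exists_eq_succ_of_ne_zero h0
    refine ⟨s, ?_, ?_⟩
    · have := Nat.find_spec hex
      rwa [hs] at this
    · simpa using Nat.find_min hex (m := s) (by omega)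
  have hQt : Q a (Nat.pair e s) = true := by simp [Q, hs0, hs1]
  refine ⟨cnt a (Nat.pair e s), ?_, ?_⟩
  · have hle : cnt a (Nat.pair e s + 1) ≤ #T := by
      have : cnt a (Nat.pair e s + 1) = #{t ∈ range (Nat.pair e s + 1) | Q a t = true} := by
        rw [Finset.card_filter]
        exact Finset.sum_congr rfl fun t _ => by cases Q a t <;> rfl
      rw [this]
      refine Finset.card_le_card_of_injOn (fun t => t.unpair.1) ?_ ?_
      · intro t ht
        simp only [coe_filter, Set.mem_ofPred_eq, Q, Bool.and_eq_true] at ht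
        exact hT _ ((hev a _).1 ⟨_, ht.2.1⟩)
      · intro t ht t' ht' h
        simp only [coe_filter, Set.mem_ofPred_eq, Q, Bool.and_eq_true, Bool.not_eq_true'] at ht ht' h
        have h2 : t.unpair.2 = t'.unpair.2 := by
          rw [h] at ht
          by_contra hne
          rcases Nat.lt_or_gt_of_ne hne with hlt | hlt
          · have := mono _ _ _ _ (Nat.succ_le_of_lt hlt) ht.2.1
            simp [ht'.2.2] at this
          · have := mono _ _ _ _ (Nat.succ_le_of_lt hlt) ht'.2.1
            simp [ht.2.2] at this
        rw [← Nat.pair_unpair t, ← Nat.pair_unpair t', h, h2]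
    have := cnt_succ a _ hQt
    omega
  · rw [Part.mem_map_iff]
    refine ⟨Nat.pair e s, ?_, by simp⟩
    refine Nat.mem_rfind_some.2 ⟨by simp [P, hQt], fun m hm => ?_⟩
    by_contra hcon
    have hPm : Q a m = true ∧ cnt a m = cnt a (Nat.pair e s) := by
      simpa [P] using hcon
    have h1 := cnt_succ a m hPm.1
    have h2 := cnt_mono a (Nat.succ_le_of_lt hm)
    simp only [Nat.succ_eq_add_one] at h2
    omega

/-! ### Mixing multigraphs -/

/-- Among the edges `e < 2 ^ (3 * n)` joining `e / 2 ^ n` to `f e`, few connect `A` to `B`, for all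
sets `A`, `B` of vertices. -/
def IsMixing (n : ℕ) (f : ℕ → ℕ) : Prop :=
  ∀ A B : Finset ℕ, A ⊆ range (2 ^ (2 * n)) → B ⊆ range (2 ^ (2 * n)) →
    2 ^ n * #{e ∈ range (2 ^ (3 * n)) | e / 2 ^ n ∈ A ∧ f e ∈ B} ≤
      3 * 2 ^ n + 2 * (#A * #B) + 2 * n * 2 ^ n * (#A + #B)

theorem card_filter_div_mem_le (m d : ℕ) (hd : 0 < d) (A : Finset ℕ) :
    #{e ∈ range m | e / d ∈ A} ≤ #A * d := by
  rw [mul_comm]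
  refine Finset.card_le_mul_card_image_of_maps_to (f := fun e => e / d) (fun e he => ?_) d
    fun b _ => ?_
  · exact (Finset.mem_filter.1 he).2
  · refine (Finset.card_le_card_of_injOn (t := range d) (fun e => e % d) (fun e _ => ?_)
      fun e he e' he' h => ?_).trans_eq (Finset.card_range d)
    · simpa using Nat.mod_lt _ hd
    · have h1 := (Finset.mem_filter.1 he).2
      have h2 := (Finset.mem_filter.1 he').2
      rw [← Nat.div_add_mod e d, ← Nat.div_add_mod e' d, h1, h2]
      simpa using h

theorem div_two_pow_lt {n e : ℕ} (he : e < 2 ^ (3 * n)) : e / 2 ^ n < 2 ^ (2 * n) := by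
  rw [Nat.div_lt_iff_lt_mul (by positivity), ← pow_add]
  exact he.trans_eq (by ring_nf)

theorem card_filter_range_eq (m : ℕ) (p : ℕ → Prop) [DecidablePred p] :
    #{e ∈ range m | p e} = #{e : Fin m | p e} := by
  rw [Finset.card_filter, Finset.card_filter, Finset.sum_range]

/-- The logarithm of `exists_pseudorandom` with `N = 2^(2n)`: at most `#A * 2^n` edges start in `A`,
`log (1 + u) ≤ u`, and `log 2 ≥ 1/2` accounts for the factor 2. Reading `f` off a list, with a
default and a reduction modulo `2^(2n)`, makes every list a valid candidate for the search. -/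
theorem exists_isMixing (n : ℕ) :
    ∃ l : List ℕ, IsMixing n fun e => l.getD e 0 % 2 ^ (2 * n) := by
  obtain ⟨F, hF⟩ := exists_pseudorandom fun e : Fin (2 ^ (3 * n)) =>
    (⟨(e : ℕ) / 2 ^ n, div_two_pow_lt e.2⟩ : Fin (2 ^ (2 * n)))
  refine ⟨List.ofFn fun e => (F e : ℕ), fun A B hA hB => ?_⟩
  have hA' : ∀ a ∈ A, a < 2 ^ (2 * n) := fun a ha => by simpa using hA ha
  have hB' : ∀ a ∈ B, a < 2 ^ (2 * n) := fun a ha => by simpa using hB ha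
  have h := hF (A.attachFin hA') (B.attachFin hB')
  simp only [mem_attachFin, card_attachFin, Fintype.card_fin] at h
  have hX : #{e ∈ range (2 ^ (3 * n)) |
      e / 2 ^ n ∈ A ∧ (List.ofFn fun e => (F e : ℕ)).getD e 0 % 2 ^ (2 * n) ∈ B} =
      #{e : Fin (2 ^ (3 * n)) | (e : ℕ) / 2 ^ n ∈ A ∧ (F e : ℕ) ∈ B} := by
    rw [card_filter_range_eq]
    congr 1
    ext e
    simp [List.getD, Nat.mod_eq_of_lt]
  rw [hX]
  have hAc : #{e : Fin (2 ^ (3 * n)) | (e : ℕ) / 2 ^ n ∈ A} ≤ #A * 2 ^ n := by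
    rw [← card_filter_range_eq (2 ^ (3 * n)) fun e => e / 2 ^ n ∈ A]
    exact card_filter_div_mem_le _ _ (by positivity) A
  set X := #{e : Fin (2 ^ (3 * n)) | (e : ℕ) / 2 ^ n ∈ A ∧ (F e : ℕ) ∈ B}
  set Y := #{e : Fin (2 ^ (3 * n)) | (e : ℕ) / 2 ^ n ∈ A}
  push_cast at h
  have hlog := Real.log_le_log (by positivity) h
  have hp : (0 : ℝ) < 2 ^ n := by positivity
  have h2 : (2 : ℝ) ^ (2 * n) = 2 ^ n * 2 ^ n := by rw [two_mul, pow_add]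
  have h8 : Real.log 8 = 3 * Real.log 2 := by
    rw [show (8 : ℝ) = 2 ^ 3 by norm_num, Real.log_pow]
    norm_num
  have hbase : Real.log (1 + (#B : ℝ) / 2 ^ (2 * n)) ≤ (#B : ℝ) / 2 ^ (2 * n) := by
    have := Real.log_le_sub_one_of_pos (show (0 : ℝ) < 1 + (#B : ℝ) / 2 ^ (2 * n) by positivity)
    linarith
  rw [Real.log_mul (by positivity) (by positivity), Real.log_mul (by positivity) (by positivity),
    Real.log_pow, Real.log_pow, Real.log_pow, Real.log_pow, h8] at hlog
  have hY : (Y : ℝ) * Real.log (1 + (#B : ℝ) / 2 ^ (2 * n)) ≤ (#A * #B : ℝ) / 2 ^ n := by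
    calc (Y : ℝ) * Real.log (1 + (#B : ℝ) / 2 ^ (2 * n))
        ≤ (#A * 2 ^ n : ℝ) * ((#B : ℝ) / 2 ^ (2 * n)) := by
          refine mul_le_mul (by exact_mod_cast hAc) hbase (Real.log_nonneg ?_) (by positivity)
          have : (0 : ℝ) ≤ (#B : ℝ) / 2 ^ (2 * n) := by positivity
          linarith
      _ = (#A * #B : ℝ) / 2 ^ n := by
          rw [h2]
          field_simp
  have hl2 : (1 / 2 : ℝ) ≤ Real.log 2 := by
    have := Real.log_two_gt_d9
    linarith
  have hnn : (0 : ℝ) ≤ (#A * #B : ℝ) / 2 ^ n := by positivity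
  have hfin : (X : ℝ) ≤ 3 + 2 * ((#A * #B : ℝ) / 2 ^ n) + 2 * n * (#A + #B) := by
    push_cast at hlog
    have : (X : ℝ) * Real.log 2 ≤
        (3 + 2 * ((#A * #B : ℝ) / 2 ^ n) + 2 * n * (#A + #B)) * Real.log 2 := by
      nlinarith
    exact le_of_mul_le_mul_right this (by linarith)
  have hfin' : (2 : ℝ) ^ n * X ≤ 3 * 2 ^ n + 2 * (#A * #B) + 2 * n * 2 ^ n * (#A + #B) := by
    calc (2 : ℝ) ^ n * X ≤ 2 ^ n * (3 + 2 * ((#A * #B : ℝ) / 2 ^ n) + 2 * n * (#A + #B)) :=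
          mul_le_mul_of_nonneg_left hfin hp.le
      _ = _ := by field_simp
  exact_mod_cast hfin'

/-! ### Computing a mixing multigraph -/

/-- The binary digit of `a` with weight `2 ^ i`. -/
def binaryDigit (a i : ℕ) : ℕ := a / 2 ^ i % 2

theorem binaryDigit_primrec : Primrec₂ binaryDigit :=
  Primrec.nat_mod.comp (Primrec.nat_div.comp Primrec.fst
    (Primrec.nat_pow.comp (Primrec.const 2) Primrec.snd)) (Primrec.const 2)

theorem exists_binaryDigit_eq (m : ℕ) (A : Finset ℕ) :
    ∃ a < 2 ^ m, ∀ i < m, binaryDigit a i = if i ∈ A then 1 else 0 := by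
  refine ⟨Nat.ofBits fun i : Fin m => decide ((i : ℕ) ∈ A), Nat.ofBits_lt_two_pow _, fun i hi => ?_⟩
  have h := Nat.testBit_ofBits_lt (fun i : Fin m => decide ((i : ℕ) ∈ A)) i hi
  rw [Nat.testBit_eq_decide_div_mod_eq] at h
  have h' := decide_eq_decide.1 h
  rw [binaryDigit]
  split_ifs with hA
  · exact h'.2 hA
  · have := mt h'.1 hA
    omega

theorem binaryDigit_eq_ite (a i : ℕ) :
    binaryDigit a i = if binaryDigit a i = 1 then 1 else 0 := by
  have : binaryDigit a i < 2 := Nat.mod_lt _ (by norm_num)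
  split_ifs <;> omega

/-- The amount by which the sets with characteristic numbers `a`, `b` violate the mixing
condition. -/
def mixingExcess (n : ℕ) (l : List ℕ) (a b : ℕ) : ℕ :=
  2 ^ n * (∑ e ∈ range (2 ^ (3 * n)),
    binaryDigit a (e / 2 ^ n) * binaryDigit b (l.getD e 0 % 2 ^ (2 * n))) -
  (3 * 2 ^ n + 2 * ((∑ i ∈ range (2 ^ (2 * n)), binaryDigit a i) *
      ∑ i ∈ range (2 ^ (2 * n)), binaryDigit b i) +
    2 * n * 2 ^ n * ((∑ i ∈ range (2 ^ (2 * n)), binaryDigit a i) +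
      ∑ i ∈ range (2 ^ (2 * n)), binaryDigit b i))

theorem mixingExcess_eq {n : ℕ} {l : List ℕ} {a b : ℕ} {A B : Finset ℕ}
    (hA : A ⊆ range (2 ^ (2 * n))) (hB : B ⊆ range (2 ^ (2 * n)))
    (ha : ∀ i < 2 ^ (2 * n), binaryDigit a i = if i ∈ A then 1 else 0)
    (hb : ∀ i < 2 ^ (2 * n), binaryDigit b i = if i ∈ B then 1 else 0) :
    mixingExcess n l a b =
      2 ^ n * #{e ∈ range (2 ^ (3 * n)) | e / 2 ^ n ∈ A ∧ l.getD e 0 % 2 ^ (2 * n) ∈ B} -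
        (3 * 2 ^ n + 2 * (#A * #B) + 2 * n * 2 ^ n * (#A + #B)) := by
  have card : ∀ (a : ℕ) (A : Finset ℕ), A ⊆ range (2 ^ (2 * n)) →
      (∀ i < 2 ^ (2 * n), binaryDigit a i = if i ∈ A then 1 else 0) →
      ∑ i ∈ range (2 ^ (2 * n)), binaryDigit a i = #A := by
    intro a A hA ha
    rw [Finset.sum_congr rfl fun i hi => ha i (Finset.mem_range.1 hi), Finset.sum_ite_mem,
      Finset.inter_eq_right.2 hA]
    simp
  rw [mixingExcess, card a A hA ha, card b B hB hb, Finset.card_filter]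
  congr 2
  refine Finset.sum_congr rfl fun e he => ?_
  rw [ha _ (div_two_pow_lt (Finset.mem_range.1 he)), hb _ (Nat.mod_lt _ (by positivity))]
  by_cases hx : e / 2 ^ n ∈ A <;> simp [hx]

/-- Truncated subtraction vanishes exactly when the inequality holds, and numbers below `2^2^(2n)`
run through all vertex sets; mixing thus becomes the vanishing of a primitive recursive sum. -/
theorem isMixing_iff (n : ℕ) (l : List ℕ) :
    (∑ a ∈ range (2 ^ 2 ^ (2 * n)), ∑ b ∈ range (2 ^ 2 ^ (2 * n)), mixingExcess n l a b) = 0 ↔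
      IsMixing n fun e => l.getD e 0 % 2 ^ (2 * n) := by
  simp only [Finset.sum_eq_zero_iff, Finset.mem_range]
  constructor
  · intro h A B hA hB
    obtain ⟨a, ha, ha'⟩ := exists_binaryDigit_eq (2 ^ (2 * n)) A
    obtain ⟨b, hb, hb'⟩ := exists_binaryDigit_eq (2 ^ (2 * n)) B
    have := h a ha b hb
    rw [mixingExcess_eq hA hB ha' hb'] at this
    exact Nat.le_of_sub_eq_zero this
  · intro h a _ b _
    rw [mixingExcess_eq (A := {i ∈ range (2 ^ (2 * n)) | binaryDigit a i = 1})
      (B := {i ∈ range (2 ^ (2 * n)) | binaryDigit b i = 1}) (Finset.filter_subset _ _)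
      (Finset.filter_subset _ _)]
    · exact Nat.sub_eq_zero_of_le (h _ _ (Finset.filter_subset _ _) (Finset.filter_subset _ _))
    · intro i hi
      rw [binaryDigit_eq_ite]
      simp [hi]
    · intro i hi
      rw [binaryDigit_eq_ite]
      simp [hi]

theorem mixingExcess_primrec :
    Primrec fun w : (ℕ × List ℕ) × ℕ × ℕ => mixingExcess w.1.1 w.1.2 w.2.1 w.2.2 := by
  have two_pow : ∀ {α : Type} [Primcodable α] {g : α → ℕ}, Primrec g → Primrec fun a => 2 ^ g a :=
    fun hg => Primrec.nat_pow.comp (Primrec.const 2) hg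
  have cmul : ∀ {α : Type} [Primcodable α] {g : α → ℕ} (c : ℕ), Primrec g →
      Primrec fun a => c * g a := fun c hg => Primrec.nat_mul.comp (Primrec.const c) hg
  have hn : Primrec fun w : (ℕ × List ℕ) × ℕ × ℕ => w.1.1 := Primrec.fst.comp Primrec.fst
  have hl : Primrec fun w : (ℕ × List ℕ) × ℕ × ℕ => w.1.2 := Primrec.snd.comp Primrec.fst
  have ha : Primrec fun w : (ℕ × List ℕ) × ℕ × ℕ => w.2.1 := Primrec.fst.comp Primrec.snd
  have hb : Primrec fun w : (ℕ × List ℕ) × ℕ × ℕ => w.2.2 := Primrec.snd.comp Primrec.snd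
  have hA : Primrec fun w : (ℕ × List ℕ) × ℕ × ℕ =>
      ∑ i ∈ range (2 ^ (2 * w.1.1)), binaryDigit w.2.1 i :=
    Primrec.sum_range (two_pow (cmul 2 hn))
      (binaryDigit_primrec.comp (ha.comp Primrec.fst) Primrec.snd)
  have hB : Primrec fun w : (ℕ × List ℕ) × ℕ × ℕ =>
      ∑ i ∈ range (2 ^ (2 * w.1.1)), binaryDigit w.2.2 i :=
    Primrec.sum_range (two_pow (cmul 2 hn))
      (binaryDigit_primrec.comp (hb.comp Primrec.fst) Primrec.snd)
  have hX : Primrec fun w : (ℕ × List ℕ) × ℕ × ℕ => ∑ e ∈ range (2 ^ (3 * w.1.1)),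
      binaryDigit w.2.1 (e / 2 ^ w.1.1) *
        binaryDigit w.2.2 (w.1.2.getD e 0 % 2 ^ (2 * w.1.1)) :=
    Primrec.sum_range (two_pow (cmul 3 hn))
      (Primrec.nat_mul.comp
        (binaryDigit_primrec.comp (ha.comp Primrec.fst)
          (Primrec.nat_div.comp Primrec.snd (two_pow (hn.comp Primrec.fst))))
        (binaryDigit_primrec.comp (hb.comp Primrec.fst)
          (Primrec.nat_mod.comp ((Primrec.list_getD 0).comp (hl.comp Primrec.fst) Primrec.snd)
            (two_pow (cmul 2 (hn.comp Primrec.fst))))))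
  exact Primrec.nat_sub.comp (Primrec.nat_mul.comp (two_pow hn) hX)
    (Primrec.nat_add.comp (Primrec.nat_add.comp (cmul 3 (two_pow hn))
      (cmul 2 (Primrec.nat_mul.comp hA hB)))
      (Primrec.nat_mul.comp (Primrec.nat_mul.comp (cmul 2 hn) (two_pow hn))
        (Primrec.nat_add.comp hA hB)))

theorem exists_computable_isMixing :
    ∃ f : ℕ → ℕ → ℕ, Computable₂ f ∧ ∀ n, (∀ e, f n e < 2 ^ (2 * n)) ∧ IsMixing n (f n) := by
  let V : ℕ → ℕ → ℕ := fun n k => ∑ a ∈ range (2 ^ 2 ^ (2 * n)), ∑ b ∈ range (2 ^ 2 ^ (2 * n)),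
    mixingExcess n (Denumerable.ofNat (List ℕ) k) a b
  have hN : Primrec fun n : ℕ => 2 ^ (2 * n) :=
    Primrec.nat_pow.comp (Primrec.const 2) (Primrec.nat_mul.comp (Primrec.const 2) Primrec.id)
  have hNN : Primrec fun n : ℕ => 2 ^ 2 ^ (2 * n) := Primrec.nat_pow.comp (Primrec.const 2) hN
  have hV : Primrec₂ V := by
    refine Primrec.sum_range (hNN.comp Primrec.fst)
      (Primrec.sum_range (hNN.comp (Primrec.fst.comp Primrec.fst)) ?_)
    have h1 : Primrec fun w : ((ℕ × ℕ) × ℕ) × ℕ => w.1.1 := Primrec.fst.comp Primrec.fst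
    exact mixingExcess_primrec.comp (Primrec.pair (Primrec.pair (Primrec.fst.comp h1)
      ((Primrec.ofNat _).comp (Primrec.snd.comp h1)))
      (Primrec.pair (Primrec.snd.comp Primrec.fst) Primrec.snd))
  have hdom : ∀ n, (Nat.rfind fun k => Part.some (decide (V n k = 0))).Dom := by
    intro n
    obtain ⟨l, hl⟩ := exists_isMixing n
    rw [Nat.rfind_some_dom]
    exact ⟨Encodable.encode l, by simpa [V] using (isMixing_iff n l).2 hl⟩
  have hdec : Computable₂ fun n k => decide (V n k = 0) :=
    (Primrec.eq.decide.comp hV (Primrec.const 0)).to_comp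
  have hpart : Partrec fun n => Nat.rfind fun k => Part.some (decide (V n k = 0)) :=
    Partrec.rfind hdec.partrec₂
  let g : ℕ → ℕ := fun n => (Nat.rfind fun k => Part.some (decide (V n k = 0))).get (hdom n)
  have hg : Computable g := hpart.of_eq fun n => (Part.some_get (hdom n)).symm
  refine ⟨fun n e => (Denumerable.ofNat (List ℕ) (g n)).getD e 0 % 2 ^ (2 * n), ?_, fun n =>
    ⟨fun e => Nat.mod_lt _ (by positivity), ?_⟩⟩
  · exact Primrec.nat_mod.to_comp.comp ((Primrec.list_getD 0).to_comp.comp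
      ((Computable.ofNat _).comp (hg.comp Computable.fst)) Computable.snd)
      (hN.to_comp.comp Computable.fst)
  · have := (Nat.mem_rfind_some.1 (Part.get_mem (hdom n))).1
    exact (isMixing_iff n _).1 (of_decide_eq_true this)

/-! ### Complexity of vertices and edges -/

/-- The unary notation of a number. -/
def stringOfNat (a : ℕ) : List Bool := List.replicate a true

theorem stringOfNat_primrec : Primrec stringOfNat := by
  have h : Primrec₂ fun (_ : ℕ) (t : ℕ × List Bool) => true :: t.2 :=
    Primrec.list_cons.comp (Primrec.const true) (Primrec.snd.comp Primrec.snd)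
  refine (Primrec.nat_rec' Primrec.id (Primrec.const []) h).of_eq fun a => ?_
  induction a with
  | zero => rfl
  | succ a ih => exact congrArg (true :: ·) ih

theorem stringOfNat_injective : Function.Injective stringOfNat :=
  List.replicate_left_injective true

open Nat.Partrec (Code) in
/-- Conditional complexity is upper semicomputable. -/
theorem DescriptionMode.IsOptimal.exists_approximation {D : DescriptionMode} (hD : D.IsOptimal) :
    ∃ W : (ℕ × ℕ) × List Bool → ℕ → Bool, Primrec₂ W ∧ ∀ a h z,
      (∃ t, W ((a, h), z) t = true) ↔ condComplexity D (stringOfNat a) z ≤ h := by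
  obtain ⟨c, hc⟩ := Code.exists_code.1 hD.1
  let prog : ℕ → List Bool := fun t => (Encodable.decode t.unpair.2).getD []
  refine ⟨fun w t => decide ((prog t).length ≤ w.1.2) &&
    decide (Code.evaln t.unpair.1 c (Encodable.encode (prog t, w.2)) =
      some (Encodable.encode (stringOfNat w.1.1))), ?_, ?_⟩
  · have ht : Primrec fun w : ((ℕ × ℕ) × List Bool) × ℕ => w.2.unpair :=
      Primrec.unpair.comp Primrec.snd
    have hp : Primrec fun w : ((ℕ × ℕ) × List Bool) × ℕ => prog w.2 :=
      Primrec.option_getD.comp (Primrec.decode.comp (Primrec.snd.comp ht)) (Primrec.const [])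
    have hz : Primrec fun w : ((ℕ × ℕ) × List Bool) × ℕ => w.1.2 := Primrec.snd.comp Primrec.fst
    have hw : Primrec fun w : ((ℕ × ℕ) × List Bool) × ℕ => w.1.1 := Primrec.fst.comp Primrec.fst
    refine Primrec.and.comp
      (Primrec.nat_le.decide.comp (Primrec.list_length.comp hp) (Primrec.snd.comp hw))
      (Primrec.eq.decide.comp (Code.primrec_evaln.comp (Primrec.pair
        (Primrec.pair (Primrec.fst.comp ht) (Primrec.const c))
        (Primrec.encode.comp (Primrec.pair hp hz))))
        (Primrec.option_some.comp (Primrec.encode.comp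
          (stringOfNat_primrec.comp (Primrec.fst.comp hw)))))
  · intro a h z
    have key : ∀ p, (∃ s, Code.evaln s c (Encodable.encode (p, z)) =
        some (Encodable.encode (stringOfNat a))) ↔ stringOfNat a ∈ D p z := by
      intro p
      have h1 := Nat.Partrec.Code.evaln_complete (c := c) (n := Encodable.encode (p, z))
        (x := Encodable.encode (stringOfNat a))
      simp only [Option.mem_def] at h1
      rw [← h1, hc]
      simp
    simp only [Bool.and_eq_true, decide_eq_true_eq]
    constructor
    · rintro ⟨t, h1, h2⟩
      exact (condComplexity_le_length ((key _).1 ⟨_, h2⟩)).trans h1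
    · intro hle
      obtain ⟨p, hp, hx⟩ := hD.exists_program (stringOfNat a) z
      obtain ⟨s, hs⟩ := (key p).2 hx
      exact ⟨Nat.pair s (Encodable.encode p), by simp [prog, hp, hle], by simpa [prog] using hs⟩

theorem DescriptionMode.IsOptimal.condComplexity_stringOfNat_le {D : DescriptionMode}
    (hD : D.IsOptimal) : ∃ c : ℕ, ∀ a m z, a < 2 ^ m →
      condComplexity D (stringOfNat a) z ≤ m + c := by
  obtain ⟨c, hc⟩ := hD.condComplexity_le (Φ := fun w => Part.some (stringOfNat w.1.2))
    (stringOfNat_primrec.comp (Primrec.snd.comp Primrec.fst)).to_comp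
  exact ⟨c, fun a m z ha => by
    simpa using hc 0 a 0 m (stringOfNat a) z (by simp) ha (Part.mem_some _)⟩

theorem computable_edge {pr : List Bool → List Bool → List Bool} (hpr : Computable₂ pr)
    {f : ℕ → ℕ → ℕ} (hf : Computable₂ f) :
    Computable₂ fun n e => pr (stringOfNat (e / 2 ^ n)) (stringOfNat (f n e)) := by
  have hdiv : Primrec fun w : ℕ × ℕ => w.2 / 2 ^ w.1 :=
    Primrec.nat_div.comp Primrec.snd (Primrec.nat_pow.comp (Primrec.const 2) Primrec.fst)
  exact hpr.comp (stringOfNat_primrec.comp hdiv).to_comp (stringOfNat_primrec.to_comp.comp hf)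

theorem DescriptionMode.IsOptimal.condComplexity_edge_le {D : DescriptionMode}
    (hD : D.IsOptimal) {pr : List Bool → List Bool → List Bool} (hpr : Computable₂ pr)
    {f : ℕ → ℕ → ℕ} (hf : Computable₂ f) : ∃ c : ℕ, ∀ n e m s z, e < 2 ^ m → n < 2 ^ s →
      condComplexity D (pr (stringOfNat (e / 2 ^ n)) (stringOfNat (f n e))) z ≤ m + 2 * s + c := by
  obtain ⟨c, hc⟩ := hD.condComplexity_le
    (Φ := fun w => Part.some (pr (stringOfNat (w.1.2 / 2 ^ w.1.1)) (stringOfNat (f w.1.1 w.1.2))))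
    ((computable_edge hpr hf).comp (Primrec.fst.comp Primrec.fst).to_comp
      (Primrec.snd.comp Primrec.fst).to_comp)
  exact ⟨c, fun n e m s z he hn => hc n e s m _ z hn he (Part.mem_some _)⟩

/-- The edges whose two ends have complexity at most `h`. -/
noncomputable def simpleEdges (D : DescriptionMode) (f : ℕ → ℕ → ℕ) (n h : ℕ) (z : List Bool) :
    Finset ℕ :=
  {e ∈ range (2 ^ (3 * n)) | condComplexity D (stringOfNat (e / 2 ^ n)) z ≤ h ∧
    condComplexity D (stringOfNat (f n e)) z ≤ h}

/-- Complexity is upper semicomputable, so the set can be enumerated from `z` and the packed pair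
`(n, h)`; an edge is described by its index of `m` bits and this pair. -/
theorem DescriptionMode.IsOptimal.condComplexity_simpleEdge_le {D : DescriptionMode}
    (hD : D.IsOptimal) {pr : List Bool → List Bool → List Bool} (hpr : Computable₂ pr)
    {f : ℕ → ℕ → ℕ} (hf : Computable₂ f) : ∃ c : ℕ, ∀ n h m s z, Nat.pair n h < 2 ^ s →
      #(simpleEdges D f n h z) ≤ 2 ^ m → ∀ e ∈ simpleEdges D f n h z,
        condComplexity D (pr (stringOfNat (e / 2 ^ n)) (stringOfNat (f n e))) z ≤
          m + 2 * s + c := by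
  obtain ⟨W, hW, hWle⟩ := hD.exists_approximation
  -- `t` packs separate witnesses for the two ends.
  let R : (ℕ × List Bool) × ℕ → ℕ → Bool := fun w t =>
    decide (w.2 < 2 ^ (3 * w.1.1.unpair.1)) &&
      (W ((w.2 / 2 ^ w.1.1.unpair.1, w.1.1.unpair.2), w.1.2) t.unpair.1 &&
        W ((f w.1.1.unpair.1 w.2, w.1.1.unpair.2), w.1.2) t.unpair.2)
  have hv : Primrec fun w : ((ℕ × List Bool) × ℕ) × ℕ => w.1.1.1.unpair :=
    Primrec.unpair.comp (Primrec.fst.comp (Primrec.fst.comp Primrec.fst))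
  have hz : Primrec fun w : ((ℕ × List Bool) × ℕ) × ℕ => w.1.1.2 :=
    Primrec.snd.comp (Primrec.fst.comp Primrec.fst)
  have he : Primrec fun w : ((ℕ × List Bool) × ℕ) × ℕ => w.1.2 := Primrec.snd.comp Primrec.fst
  have ht : Primrec fun w : ((ℕ × List Bool) × ℕ) × ℕ => w.2.unpair :=
    Primrec.unpair.comp Primrec.snd
  have hn := Primrec.fst.comp hv
  have hh := Primrec.snd.comp hv
  have h1 : Primrec fun w : ((ℕ × List Bool) × ℕ) × ℕ =>
      decide (w.1.2 < 2 ^ (3 * w.1.1.1.unpair.1)) :=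
    Primrec.nat_lt.decide.comp he (Primrec.nat_pow.comp (Primrec.const 2)
      (Primrec.nat_mul.comp (Primrec.const 3) hn))
  have h2 := hW.comp (Primrec.pair (Primrec.pair
    (Primrec.nat_div.comp he (Primrec.nat_pow.comp (Primrec.const 2) hn)) hh) hz)
    (Primrec.fst.comp ht)
  have h3 := hW.to_comp.comp (Computable.pair (Computable.pair
    (hf.comp hn.to_comp he.to_comp) hh.to_comp) hz.to_comp) (Primrec.snd.comp ht).to_comp
  have hR : Computable₂ R :=
    Primrec.and.to_comp.comp h1.to_comp (Primrec.and.to_comp.comp h2.to_comp h3)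
  have hRmem : ∀ n h z e, (∃ t, R ((Nat.pair n h, z), e) t = true) ↔
      e ∈ simpleEdges D f n h z := by
    intro n h z e
    simp only [R, simpleEdges, Finset.mem_filter, Finset.mem_range, ← hWle, Bool.and_eq_true,
      decide_eq_true_eq, Nat.unpair_pair]
    constructor
    · rintro ⟨t, h1, h2, h3⟩
      exact ⟨h1, ⟨_, h2⟩, ⟨_, h3⟩⟩
    · rintro ⟨h1, ⟨t, h2⟩, ⟨t', h3⟩⟩
      exact ⟨Nat.pair t t', by simpa using ⟨h1, h2, h3⟩⟩
  obtain ⟨F, hF, hFmem⟩ := exists_partrec_enumeration hR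
  obtain ⟨c, hc⟩ := hD.condComplexity_le
    (Φ := fun w => (F ((w.1.1, w.2), w.1.2)).map fun e =>
      pr (stringOfNat (e / 2 ^ w.1.1.unpair.1)) (stringOfNat (f w.1.1.unpair.1 e)))
    ((hF.comp (Primrec.pair (Primrec.pair (Primrec.fst.comp Primrec.fst) Primrec.snd)
      (Primrec.snd.comp Primrec.fst)).to_comp).map
      ((computable_edge hpr hf).comp (Primrec.fst.comp (Primrec.unpair.comp
        (Primrec.fst.comp (Primrec.fst.comp Primrec.fst)))).to_comp Computable.snd).to₂)
  refine ⟨c, fun n h m s z hs hm e he => ?_⟩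
  obtain ⟨i, hi, hiF⟩ := hFmem (Nat.pair n h, z) (simpleEdges D f n h z)
    (fun e he => (hRmem _ _ _ _).1 he) e ((hRmem _ _ _ _).2 he)
  refine hc (Nat.pair n h) i s m _ z hs (hi.trans_le hm) ?_
  rw [Part.mem_map_iff]
  exact ⟨e, hiF, by simp⟩

theorem DescriptionMode.IsOptimal.card_filter_range_le {D : DescriptionMode} (hD : D.IsOptimal)
    (N h : ℕ) (z : List Bool) :
    #{a ∈ range N | condComplexity D (stringOfNat a) z ≤ h} ≤ 2 ^ (h + 1) :=
  hD.card_le stringOfNat_injective z h _ fun _ ha => (Finset.mem_filter.1 ha).2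

/-- Mixing for `A = B`, the at most `2^(h+1)` vertices of complexity at most `h`. -/
theorem DescriptionMode.IsOptimal.card_simpleEdges_le {D : DescriptionMode} (hD : D.IsOptimal)
    {f : ℕ → ℕ → ℕ} {n : ℕ} (hlt : ∀ e, f n e < 2 ^ (2 * n)) (hmix : IsMixing n (f n)) (h : ℕ)
    (z : List Bool) : 2 ^ n * #(simpleEdges D f n h z) ≤
      3 * 2 ^ n + 8 * 2 ^ (2 * h) + 8 * n * 2 ^ n * 2 ^ h := by
  set A : Finset ℕ := {a ∈ range (2 ^ (2 * n)) | condComplexity D (stringOfNat a) z ≤ h} with hA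
  have hc : #A ≤ 2 * 2 ^ h := (hD.card_filter_range_le (2 ^ (2 * n)) h z).trans_eq (by ring)
  have hS : simpleEdges D f n h z ⊆
      {e ∈ range (2 ^ (3 * n)) | e / 2 ^ n ∈ A ∧ f n e ∈ A} := by
    intro e he
    simp only [simpleEdges, Finset.mem_filter, Finset.mem_range, hA] at he ⊢
    exact ⟨he.1, ⟨div_two_pow_lt he.1, he.2.1⟩, hlt e, he.2.2⟩
  calc 2 ^ n * #(simpleEdges D f n h z)
      ≤ 3 * 2 ^ n + 2 * (#A * #A) + 2 * n * 2 ^ n * (#A + #A) :=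
        (Nat.mul_le_mul_left _ (Finset.card_le_card hS)).trans
          (hmix A A (Finset.filter_subset _ _) (Finset.filter_subset _ _))
    _ ≤ 3 * 2 ^ n + 2 * ((2 * 2 ^ h) * (2 * 2 ^ h)) + 2 * n * 2 ^ n * (2 * 2 ^ h + 2 * 2 ^ h) := by
        gcongr
    _ = _ := by ring

/-- The main term gives at most a sixteenth of all edges; the rest fits in another sixteenth once
`2^n ≥ 64n + 48`, which `10 ≤ n` ensures. -/
theorem eight_mul_le_of_mixing_bound {n a X : ℕ} (hn : 10 ≤ n) (ha : 32 * a ≤ 2 ^ (2 * n))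
    (h : 2 ^ n * X ≤ 3 * 2 ^ n + 2 * (a * 2 ^ (2 * n)) + 2 * n * 2 ^ n * (a + 2 ^ (2 * n))) :
    8 * X ≤ 2 ^ (3 * n) := by
  have hP : 64 * n + 48 ≤ 2 ^ n := by
    clear ha h
    induction n, hn using Nat.le_induction with
    | base => norm_num
    | succ k hk ih => rw [pow_succ]; omega
  have e2 : 2 ^ (2 * n) = 2 ^ n * 2 ^ n := by ring
  have e3 : 2 ^ (3 * n) = 2 ^ n * 2 ^ n * 2 ^ n := by ring
  rw [e2] at ha h
  rw [e3]
  generalize 2 ^ n = P at *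
  have hP0 : 0 < P := by omega
  refine le_of_mul_le_mul_left (a := P) ?_ hP0
  have h1 : 32 * a * (P * P) ≤ P * P * (P * P) := Nat.mul_le_mul_right _ ha
  have h2 : 2 * n * P * (32 * a) ≤ 2 * n * P * (P * P) := Nat.mul_le_mul_left _ ha
  have h3 : (64 * n + 48) * (P * P * P) ≤ P * (P * P * P) := Nat.mul_le_mul_right _ hP
  have h4 : P * 1 ≤ P * (P * P) := Nat.mul_le_mul_left _ (Nat.mul_pos hP0 hP0)
  nlinarith

/-- Edges with a simple left end, a simple right end, or a simple pair each make up at most an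
eighth of all edges, so some edge avoids all three kinds. -/
theorem DescriptionMode.IsOptimal.exists_complex_edge {D : DescriptionMode} (hD : D.IsOptimal)
    {pr : List Bool → List Bool → List Bool} (hpr : Function.Injective2 pr)
    {f : ℕ → ℕ → ℕ} {n : ℕ} (hlt : ∀ e, f n e < 2 ^ (2 * n)) (hmix : IsMixing n (f n))
    (hn : 10 ≤ n) {t : ℕ} (ht : 16 * (4 * n + 5) ≤ 2 ^ t) (htn : t ≤ 3 * n) (z : List Bool) :
    ∃ e < 2 ^ (3 * n), 2 * n ≤ condComplexity D (stringOfNat (e / 2 ^ n)) z + 5 ∧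
      2 * n ≤ condComplexity D (stringOfNat (f n e)) z + 5 ∧
      3 * n ≤ condComplexity D (pr (stringOfNat (e / 2 ^ n)) (stringOfNat (f n e))) z + t := by
  -- At most `2^(k+1) = 2^(2n)/32` vertices have complexity at most `k`.
  obtain ⟨k, hk⟩ : ∃ k, 2 * n = k + 6 := ⟨2 * n - 6, by omega⟩
  obtain ⟨k', hk'⟩ : ∃ k', 3 * n = k' + t := ⟨3 * n - t, by omega⟩
  set A : Finset ℕ := {a ∈ range (2 ^ (2 * n)) | condComplexity D (stringOfNat a) z ≤ k} with hA
  have hAc : 32 * #A ≤ 2 ^ (2 * n) :=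
    (Nat.mul_le_mul_left 32 (hD.card_filter_range_le (2 ^ (2 * n)) k z)).trans_eq (by
      rw [hk]; ring)
  have hsub : A ⊆ range (2 ^ (2 * n)) := Finset.filter_subset _ _
  have hX := hmix A (range (2 ^ (2 * n))) hsub subset_rfl
  have hY := hmix (range (2 ^ (2 * n))) A subset_rfl hsub
  rw [mul_comm #(range (2 ^ (2 * n))) #A, add_comm #(range (2 ^ (2 * n))) #A] at hY
  rw [Finset.card_range] at hX hY
  have hX' := eight_mul_le_of_mixing_bound hn hAc hX
  have hY' := eight_mul_le_of_mixing_bound hn hAc hY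
  set S : Finset ℕ := {e ∈ range (2 ^ (3 * n)) |
    condComplexity D (pr (stringOfNat (e / 2 ^ n)) (stringOfNat (f n e))) z ≤ k'} with hS
  have hSc : #S ≤ (4 * n + 5) * 2 ^ (k' + 1) := by
    let g : ℕ → ℕ × ℕ := fun e => (e / 2 ^ n, f n e)
    have himg : #(S.image g) ≤ 2 ^ (k' + 1) := by
      refine hD.card_le (f := fun w : ℕ × ℕ => pr (stringOfNat w.1) (stringOfNat w.2)) ?_ z k' _ ?_
      · rintro ⟨a, b⟩ ⟨a', b'⟩ h
        obtain ⟨h1, h2⟩ := hpr h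
        exact Prod.ext (stringOfNat_injective h1) (stringOfNat_injective h2)
      · intro w hw
        obtain ⟨e, he, rfl⟩ := Finset.mem_image.1 hw
        exact (Finset.mem_filter.1 he).2
    -- Parallel edges give the same pair; mixing for two singletons bounds their number by `3 +
    -- 2/2^n + 4n`.
    refine (Finset.card_le_mul_card_image S (4 * n + 5) fun w hw => ?_).trans
      (Nat.mul_le_mul_left _ himg)
    obtain ⟨e₀, he₀, rfl⟩ := Finset.mem_image.1 hw
    have he₀' : e₀ < 2 ^ (3 * n) := Finset.mem_range.1 (Finset.mem_filter.1 he₀).1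
    have hm := hmix {e₀ / 2 ^ n} {f n e₀} (by simpa using div_two_pow_lt he₀')
      (by simpa using hlt e₀)
    have hle : #{e ∈ S | g e = g e₀} ≤
        #{e ∈ range (2 ^ (3 * n)) | e / 2 ^ n ∈ ({e₀ / 2 ^ n} : Finset ℕ) ∧
          f n e ∈ ({f n e₀} : Finset ℕ)} := by
      refine Finset.card_le_card fun e he => ?_
      obtain ⟨h1, h2⟩ := Finset.mem_filter.1 he
      obtain ⟨h3, h4⟩ := Prod.mk.inj h2
      exact Finset.mem_filter.2 ⟨(Finset.mem_filter.1 h1).1, by simpa using h3, by simpa using h4⟩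
    refine hle.trans (le_of_mul_le_mul_left (a := 2 ^ n) (hm.trans ?_) (by positivity))
    simp only [Finset.card_singleton]
    have : 1 ≤ 2 ^ n := Nat.one_le_two_pow
    nlinarith
  have hS' : 8 * #S ≤ 2 ^ (3 * n) := by
    calc 8 * #S ≤ 8 * ((4 * n + 5) * 2 ^ (k' + 1)) := Nat.mul_le_mul_left _ hSc
      _ = 16 * (4 * n + 5) * 2 ^ k' := by ring
      _ ≤ 2 ^ t * 2 ^ k' := Nat.mul_le_mul_right _ ht
      _ = 2 ^ (3 * n) := by rw [hk']; ring
  set SX : Finset ℕ := {e ∈ range (2 ^ (3 * n)) | e / 2 ^ n ∈ A ∧ f n e ∈ range (2 ^ (2 * n))}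
  set SY : Finset ℕ := {e ∈ range (2 ^ (3 * n)) | e / 2 ^ n ∈ range (2 ^ (2 * n)) ∧ f n e ∈ A}
  have hcard : #(SX ∪ SY ∪ S) < #(range (2 ^ (3 * n))) := by
    have h1 := Finset.card_union_le (SX ∪ SY) S
    have h2 := Finset.card_union_le SX SY
    have h3 : 0 < 2 ^ (3 * n) := by positivity
    rw [Finset.card_range]
    omega
  obtain ⟨e, he, hne⟩ := Finset.exists_mem_notMem_of_card_lt_card hcard
  have he' := Finset.mem_range.1 he
  simp only [Finset.mem_union, not_or] at hne
  obtain ⟨⟨h1, h2⟩, h3⟩ := hne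
  have hdiv := div_two_pow_lt he'
  refine ⟨e, he', ?_, ?_, ?_⟩
  · by_contra hcon
    exact h1 (Finset.mem_filter.2 ⟨he, Finset.mem_filter.2 ⟨Finset.mem_range.2 hdiv, by omega⟩,
      Finset.mem_range.2 (hlt e)⟩)
  · by_contra hcon
    exact h2 (Finset.mem_filter.2 ⟨he, Finset.mem_range.2 hdiv,
      Finset.mem_filter.2 ⟨Finset.mem_range.2 (hlt e), by omega⟩⟩)
  · by_contra hcon
    exact h3 (Finset.mem_filter.2 ⟨he, by omega⟩)

/-! ### Logarithmic error terms and the choice of the pair -/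

theorem pair_lt_of_le {n h ℓ c : ℕ} (hh : h ≤ 2 * n + c) (hn : c + 10 ≤ n) (hℓ : n < 2 ^ ℓ) :
    Nat.pair n h < 2 ^ (3 * ℓ) := by
  have h1 : max n h + 1 ≤ 3 * n := by omega
  calc Nat.pair n h < (max n h + 1) ^ 2 := Nat.pair_lt_max_add_one_sq n h
    _ ≤ (3 * n) ^ 2 := Nat.pow_le_pow_left h1 2
    _ ≤ n ^ 3 := by
        have : 9 * n ^ 2 ≤ n * n ^ 2 := Nat.mul_le_mul_right _ (by omega)
        calc (3 * n) ^ 2 = 9 * n ^ 2 := by ring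
          _ ≤ n * n ^ 2 := this
          _ = n ^ 3 := by ring
    _ ≤ (2 ^ ℓ) ^ 3 := Nat.pow_le_pow_left hℓ.le 3
    _ = 2 ^ (3 * ℓ) := by rw [← pow_mul, mul_comm]

theorem clog_le_of_card_le {n h S : ℕ} {ε : ℝ} (hε : 0 < ε) (hn : 10 ≤ n)
    (hh : (h : ℝ) < (1 + ε) * n)
    (hS : 2 ^ n * S ≤ 3 * 2 ^ n + 8 * 2 ^ (2 * h) + 8 * n * 2 ^ n * 2 ^ h) :
    (Nat.clog 2 S : ℝ) ≤ (1 + 2 * ε) * n + 2 * Real.log n + 9 := by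
  have hn0 : (10 : ℝ) ≤ n := by exact_mod_cast hn
  have hlogn : 0 ≤ Real.log n := Real.log_nonneg (by linarith)
  rcases Nat.lt_or_ge 1 S with hS1 | hS1
  swap
  · rw [Nat.clog_of_right_le_one hS1]
    push_cast
    positivity
  set m := Nat.clog 2 S
  have hm : 2 ^ m ≤ 2 * S := by
    have h1 : 0 < m := Nat.clog_pos (by norm_num) hS1
    have h2 := Nat.pow_pred_clog_lt_self (b := 2) (by norm_num) hS1
    obtain ⟨k, hk⟩ := Nat.exists_eq_succ_of_ne_zero h1.ne'
    change 2 ^ m.pred < S at h2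
    rw [hk] at h2 ⊢
    simp only [Nat.pred_succ] at h2
    rw [Nat.succ_eq_add_one, pow_succ]
    omega
  have hm' : (2 : ℝ) ^ m ≤ 2 * S := by exact_mod_cast hm
  have hS' : (2 : ℝ) ^ n * S ≤ 3 * 2 ^ n + 8 * 2 ^ (2 * h) + 8 * n * 2 ^ n * 2 ^ h := by
    exact_mod_cast hS
  -- `Z` dominates both `2^(2h-n)` and `2^h`; the first is why `ε` is doubled.
  set Z : ℝ := (2 : ℝ) ^ ((1 + 2 * ε) * n) with hZ
  have hεn : 0 < ε * n := by positivity
  have hZ1 : 1 ≤ Z := Real.one_le_rpow (by norm_num) (by positivity)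
  have hh1 : (2 : ℝ) ^ h ≤ Z := by
    rw [hZ, ← Real.rpow_natCast]
    exact Real.rpow_le_rpow_of_exponent_le (by norm_num) (by nlinarith)
  have hh2 : (2 : ℝ) ^ (2 * h) ≤ 2 ^ n * Z := by
    rw [hZ, ← Real.rpow_natCast, ← Real.rpow_natCast, ← Real.rpow_add (by norm_num)]
    refine Real.rpow_le_rpow_of_exponent_le (by norm_num) ?_
    push_cast
    nlinarith
  have hp : (0 : ℝ) < 2 ^ n := by positivity
  have hSZ : (S : ℝ) ≤ 10 * n * Z := by
    refine le_of_mul_le_mul_left (a := (2 : ℝ) ^ n) ?_ hp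
    have h1 : 8 * n * 2 ^ n * (2 : ℝ) ^ h ≤ 8 * n * 2 ^ n * Z :=
      mul_le_mul_of_nonneg_left hh1 (by positivity)
    have h2 : 3 * (2 : ℝ) ^ n * 1 ≤ 3 * 2 ^ n * Z :=
      mul_le_mul_of_nonneg_left hZ1 (by positivity)
    have h3 : 11 * ((2 : ℝ) ^ n * Z) ≤ (2 * n) * ((2 : ℝ) ^ n * Z) :=
      mul_le_mul_of_nonneg_right (by linarith) (by positivity)
    nlinarith
  have hfin : (2 : ℝ) ^ m ≤ 20 * (n * Z) := by linarith
  have hlog := Real.log_le_log (by positivity) hfin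
  rw [Real.log_pow, Real.log_mul (by norm_num) (by positivity),
    Real.log_mul (by positivity) (by positivity), hZ, Real.log_rpow (by norm_num)] at hlog
  have hl2 : (1 / 2 : ℝ) ≤ Real.log 2 := by
    have := Real.log_two_gt_d9
    linarith
  have h20 : Real.log 20 ≤ 5 * Real.log 2 := by
    rw [← Real.log_rpow (by norm_num)]
    exact Real.log_le_log (by norm_num) (by norm_num)
  have : (m : ℝ) * Real.log 2 ≤ ((1 + 2 * ε) * n + 2 * Real.log n + 9) * Real.log 2 := by
    nlinarith
  exact le_of_mul_le_mul_right this (by linarith)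

/-- One pair of strings for each large `n` is not extractable for all `ε` at once. -/
theorem exists_isNonExtractable (D : DescriptionMode) (hD : D.IsOptimal)
    (pr : List Bool → List Bool → List Bool) (hpr : IsPairing pr) :
    ∃ c : ℝ, 0 < c ∧ ∃ n₀ : ℕ, ∀ n, n₀ ≤ n → ∃ x y : List Bool, ∀ ε : ℝ, 0 < ε →
      IsNonExtractable D pr 2 c ε n x y := by
  obtain ⟨f, hf, hmix⟩ := exists_computable_isMixing
  obtain ⟨c₁, hc₁⟩ := hD.condComplexity_stringOfNat_le
  obtain ⟨c₂, hc₂⟩ := hD.condComplexity_edge_le hpr.1 hf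
  obtain ⟨c₃, hc₃⟩ := hD.condComplexity_simpleEdge_le hpr.1 hf
  -- The largest error is `2 log n + 9 + 6ℓ + c₃`, at most `29 log n + c₃` as `ℓ ≤ 3 log n` and `log
  -- n ≥ 1`.
  refine ⟨(c₁ + c₂ + c₃ + 40 : ℕ), by positivity, c₁ + 10, fun n hn => ?_⟩
  obtain ⟨ℓ, hℓ, hℓlog⟩ : ∃ ℓ, n < 2 ^ ℓ ∧ ℓ = Nat.log 2 n + 1 :=
    ⟨_, Nat.lt_pow_succ_log_self (by norm_num) n, rfl⟩
  have hlogn : Nat.log 2 n < n := Nat.log_lt_self 2 (by omega)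
  have hn0 : (10 : ℝ) ≤ n := by exact_mod_cast (by omega : 10 ≤ n)
  have hlog1 : 1 ≤ Real.log n := by
    rw [Real.le_log_iff_exp_le (by linarith)]
    have := Real.exp_one_lt_d9
    linarith
  have hℓ3 : (ℓ : ℝ) ≤ 3 * Real.log n := by
    have h1 : (2 : ℝ) ^ Nat.log 2 n ≤ n := by
      exact_mod_cast Nat.pow_log_le_self 2 (by omega)
    have h2 := Real.log_le_log (by positivity) h1
    rw [Real.log_pow] at h2
    have h3 := Real.log_two_gt_d9
    have h4 : (0 : ℝ) ≤ Nat.log 2 n := by positivity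
    rw [hℓlog]
    push_cast
    nlinarith
  obtain ⟨e, he, hx, hy, hxy⟩ := hD.exists_complex_edge hpr.2 (hmix n).1 (hmix n).2
    (by omega : 10 ≤ n) (t := ℓ + 8) (by rw [pow_add]; omega) (by omega) []
  have hxu := hc₁ (e / 2 ^ n) (2 * n)
  have hyu := hc₁ (f n e) (2 * n)
  have hxyu := hc₂ n e (3 * n) ℓ [] he hℓ
  have hdiv := div_two_pow_lt he
  have hfe := (hmix n).1 e
  set x := stringOfNat (e / 2 ^ n)
  set y := stringOfNat (f n e)
  have hxu' := hxu [] hdiv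
  have hyu' := hyu [] hfe
  have c1 : (0 : ℝ) ≤ c₁ := by positivity
  have c2 : (0 : ℝ) ≤ c₂ := by positivity
  have c3 : (0 : ℝ) ≤ c₃ := by positivity
  have m1 : (c₁ : ℝ) * 1 ≤ c₁ * Real.log n := mul_le_mul_of_nonneg_left hlog1 c1
  have m2 : (c₂ : ℝ) * 1 ≤ c₂ * Real.log n := mul_le_mul_of_nonneg_left hlog1 c2
  have m3 : (c₃ : ℝ) * 1 ≤ c₃ * Real.log n := mul_le_mul_of_nonneg_left hlog1 c3
  refine ⟨x, y, fun ε hε => ⟨?_, ?_, ?_, fun z hxz hyz => ?_⟩⟩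
  · have h1 : (2 * n : ℝ) ≤ condComplexity D x [] + 5 := by exact_mod_cast hx
    have h2 : (condComplexity D x [] : ℝ) ≤ 2 * n + c₁ := by exact_mod_cast hxu'
    rw [plainComplexity, abs_le]
    push_cast
    constructor <;> nlinarith
  · have h1 : (2 * n : ℝ) ≤ condComplexity D y [] + 5 := by exact_mod_cast hy
    have h2 : (condComplexity D y [] : ℝ) ≤ 2 * n + c₁ := by exact_mod_cast hyu'
    rw [plainComplexity, abs_le]
    push_cast
    constructor <;> nlinarith
  · have h1 : (3 * n : ℝ) ≤ condComplexity D (pr x y) [] + (ℓ + 8) := by exact_mod_cast hxy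
    have h2 : (condComplexity D (pr x y) [] : ℝ) ≤ 3 * n + 2 * ℓ + c₂ := by exact_mod_cast hxyu
    rw [plainComplexity, abs_le]
    push_cast
    constructor <;> nlinarith
  -- The program uses the actual complexities through `h` and never `ε`, so one edge serves all `ε`.
  · set h := max (condComplexity D x z) (condComplexity D y z) with hh
    have hhε : (h : ℝ) < (1 + ε) * n := by
      rw [hh, Nat.cast_max]
      exact max_lt hxz hyz
    have hhu : h ≤ 2 * n + c₁ := max_le (hxu z hdiv) (hyu z hfe)
    have hmem : e ∈ simpleEdges D f n h z :=
      Finset.mem_filter.2 ⟨Finset.mem_range.2 he, le_max_left _ _, le_max_right _ _⟩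
    have h1 := hc₃ n h _ (3 * ℓ) z (pair_lt_of_le hhu hn hℓ)
      (Nat.le_pow_clog (by norm_num) _) e hmem
    have h2 := clog_le_of_card_le hε (by omega) hhε
      (hD.card_simpleEdges_le (hmix n).1 (hmix n).2 h z)
    have h3 : (condComplexity D (pr x y) z : ℝ) ≤
        Nat.clog 2 #(simpleEdges D f n h z) + 2 * (3 * ℓ) + c₃ := by exact_mod_cast h1
    push_cast
    nlinarith

end Combinatorics

/-! ### Asymptotics and the main theorem -/

theorem isLittleO_log_natCast :
    (fun n : ℕ => Real.log n) =o[atTop] (fun n : ℕ => (n : ℝ)) :=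
  Real.isLittleO_log_id_atTop.comp_tendsto tendsto_natCast_atTop_atTop

theorem isTheta_natCast_of_abs_sub_le_log {a : ℕ → ℝ} {k c : ℝ} (hk : k ≠ 0)
    (h : ∀ᶠ n : ℕ in atTop, |a n - k * n| ≤ c * Real.log n) :
    a =Θ[atTop] (fun n : ℕ => (n : ℝ)) := by
  have h1 : (fun n : ℕ => a n - k * n) =O[atTop] fun n : ℕ => Real.log n := by
    refine IsBigO.of_bound c ?_
    filter_upwards [h, eventually_ge_atTop 1] with n hn h1
    rwa [Real.norm_eq_abs, Real.norm_of_nonneg (Real.log_nonneg (by exact_mod_cast h1))]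
  have h2 : (fun n : ℕ => a n - k * n) =o[atTop] fun n : ℕ => k * (n : ℝ) :=
    (isLittleO_const_mul_right_iff hk).2 (h1.trans_isLittleO isLittleO_log_natCast)
  have h3 : (fun n : ℕ => k * (n : ℝ)) =Θ[atTop] fun n : ℕ => (n : ℝ) :=
    (isTheta_const_mul_left hk).2 (isTheta_refl _ _)
  exact (IsEquivalent.isTheta (u := a) (v := fun n : ℕ => k * (n : ℝ)) h2).trans h3

theorem tendsto_one_div_sqrt_natCast_add_one :
    Tendsto (fun n : ℕ => 1 / √((n : ℝ) + 1)) atTop (nhds 0) := by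
  have h : Tendsto (fun n : ℕ => √((n : ℝ) + 1)) atTop atTop :=
    Real.tendsto_sqrt_atTop.comp
      (tendsto_atTop_add_const_right _ _ tendsto_natCast_atTop_atTop)
  simpa only [one_div] using! h.inv_tendsto_atTop

/-- The right side is at least `√n / 2`, which beats any multiple of `log n`: the rate `1/√(n+1)`
tends to zero slowly enough to absorb logarithmic errors. -/
theorem eventually_mul_log_lt (κ : ℝ) :
    ∀ᶠ n : ℕ in atTop, κ * Real.log n < 1 / √((n : ℝ) + 1) * n := by
  have h : (fun n : ℕ => Real.log n) =o[atTop] fun n : ℕ => (n : ℝ) ^ (1 / 2 : ℝ) :=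
    (isLittleO_log_rpow_atTop (by norm_num)).comp_tendsto tendsto_natCast_atTop_atTop
  have hb := h.def (c := 1 / (4 * (|κ| + 1))) (by positivity)
  filter_upwards [hb, eventually_ge_atTop 1] with n hn h1
  have h1' : (1 : ℝ) ≤ n := by exact_mod_cast h1
  rw [← Real.sqrt_eq_rpow, Real.norm_of_nonneg (Real.log_nonneg h1'),
    Real.norm_of_nonneg (Real.sqrt_nonneg _)] at hn
  have hs : 0 < √(n : ℝ) := Real.sqrt_pos.2 (by linarith)
  have hs' : √((n : ℝ) + 1) ≤ 2 * √(n : ℝ) := by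
    rw [Real.sqrt_le_left (by positivity), mul_pow, Real.sq_sqrt (by linarith)]
    linarith
  have hlow : √(n : ℝ) / 2 ≤ 1 / √((n : ℝ) + 1) * n := by
    rw [one_div_mul_eq_div, le_div_iff₀ (Real.sqrt_pos.2 (by linarith))]
    calc √(n : ℝ) / 2 * √((n : ℝ) + 1) ≤ √(n : ℝ) / 2 * (2 * √(n : ℝ)) :=
          mul_le_mul_of_nonneg_left hs' (by positivity)
      _ = √(n : ℝ) * √(n : ℝ) := by ring
      _ = n := Real.mul_self_sqrt (by linarith)
  have hk : κ * Real.log n ≤ √(n : ℝ) / 4 := by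
    calc κ * Real.log n ≤ (|κ| + 1) * Real.log n :=
          mul_le_mul_of_nonneg_right (by linarith [le_abs_self κ]) (Real.log_nonneg h1')
      _ ≤ (|κ| + 1) * (1 / (4 * (|κ| + 1)) * √(n : ℝ)) :=
          mul_le_mul_of_nonneg_left hn (by positivity)
      _ = √(n : ℝ) / 4 := by field_simp
  linarith

theorem mainTheorem5 (D : DescriptionMode) (hD : D.IsOptimal)
    (pr : List Bool → List Bool → List Bool) (hpr : IsPairing pr) :
    ∃ K c : ℝ, 0 < K ∧ 0 < c ∧
      (∀ ε : ℝ, 0 < ε → ∃ n₀ : ℕ, ∀ n : ℕ, n₀ ≤ n →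
        ∃ x y : List Bool, IsNonExtractable D pr K c ε n x y) ∧
      ∃ (x y : ℕ → List Bool) (e : ℕ → ℝ),
        -- the pairs `(x n, y n)` are as above, with parameters `e n` that tend to zero
        (∀ n, 0 < e n) ∧ Tendsto e atTop (nhds 0) ∧
        (∀ᶠ n in atTop, IsNonExtractable D pr K c (e n) n (x n) (y n)) ∧
        -- the three strings have complexity `Θ(n)`, the third one `3n + O(log n)`
        (fun n => (plainComplexity D (x n) : ℝ)) =Θ[atTop] (fun n => (n : ℝ)) ∧
        (fun n => (plainComplexity D (y n) : ℝ)) =Θ[atTop] (fun n => (n : ℝ)) ∧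
        (fun n => (plainComplexity D (pr (x n) (y n)) : ℝ)) =Θ[atTop] (fun n => (n : ℝ)) ∧
        (fun n => (1 / 2) * (plainComplexity D (pr (x n) (y n)) : ℝ) - (3 / 2) * n)
          =O[atTop] (fun n : ℕ => Real.log n) ∧
        -- no string halves all three complexities up to `O(log n)`
        (∀ κ : ℝ, ∀ᶠ n : ℕ in atTop, ¬ ∃ z : List Bool,
          Halves D (x n) z (κ * Real.log n) ∧
          Halves D (y n) z (κ * Real.log n) ∧
          Halves D (pr (x n) (y n)) z (κ * Real.log n)) ∧
        -- a string that halves the first two leaves the third one at most `n + o(n)` bits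
        (∀ κ : ℝ, ∃ g : ℕ → ℝ, g =o[atTop] (fun n => (n : ℝ)) ∧
          (∃ δ : ℝ, 0 < δ ∧ ∀ᶠ n : ℕ in atTop, n + g n + δ * n ≤ (3 / 2) * n) ∧
          ∀ᶠ n : ℕ in atTop, ∀ z : List Bool,
            Halves D (x n) z (κ * Real.log n) →
            Halves D (y n) z (κ * Real.log n) →
            (condComplexity D (pr (x n) (y n)) z : ℝ) ≤ n + g n) := by
  obtain ⟨c, hc, n₀, hn₀⟩ := exists_isNonExtractable D hD pr hpr
  refine ⟨2, c, by norm_num, hc, fun ε hε => ⟨n₀, fun n hn => ?_⟩, ?_⟩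
  · obtain ⟨x, y, h⟩ := hn₀ n hn
    exact ⟨x, y, h ε hε⟩
  -- Empty strings fill in below `n₀`.
  have hex : ∀ n, ∃ x y : List Bool, n₀ ≤ n → ∀ ε : ℝ, 0 < ε →
      IsNonExtractable D pr 2 c ε n x y := fun n => by
    by_cases hn : n₀ ≤ n
    · obtain ⟨x, y, h⟩ := hn₀ n hn
      exact ⟨x, y, fun _ => h⟩
    · exact ⟨[], [], fun h => absurd h hn⟩
  choose x y hxy using hex
  let e : ℕ → ℝ := fun n => 1 / √((n : ℝ) + 1)
  have he : ∀ n, 0 < e n := fun n => by positivity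
  have hne : ∀ᶠ n in atTop, IsNonExtractable D pr 2 c (e n) n (x n) (y n) := by
    filter_upwards [eventually_ge_atTop n₀] with n hn using hxy n hn _ (he n)
  have hprof : ∀ᶠ n : ℕ in atTop,
      |(plainComplexity D (pr (x n) (y n)) : ℝ) - 3 * n| ≤ c * Real.log n :=
    hne.mono fun n h => h.2.2.1
  let g : ℕ → ℝ := fun n => 2 * (e n * n) + c * Real.log n
  have hg : g =o[atTop] fun n : ℕ => (n : ℝ) := by
    have h1 : (fun n : ℕ => e n * n) =o[atTop] fun n : ℕ => (n : ℝ) := by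
      simpa only [one_mul] using! ((isLittleO_one_iff ℝ).2 tendsto_one_div_sqrt_natCast_add_one).mul_isBigO
        (isBigO_refl (fun n : ℕ => (n : ℝ)) atTop)
    exact (h1.const_mul_left 2).add (isLittleO_log_natCast.const_mul_left c)
  have hgle : ∀ᶠ n : ℕ in atTop, g n ≤ 1 / 4 * n := by
    filter_upwards [hg.def (c := 1 / 4) (by norm_num)] with n hn
    simpa using (le_abs_self _).trans hn
  have hup : ∀ κ : ℝ, ∀ᶠ n : ℕ in atTop, ∀ z : List Bool,
      Halves D (x n) z (κ * Real.log n) → Halves D (y n) z (κ * Real.log n) →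
        (condComplexity D (pr (x n) (y n)) z : ℝ) ≤ n + g n := by
    intro κ
    -- Each end has conditional complexity at most `n + (c/2 + κ) log n`, which is below `(1 + e n)
    -- n`.
    filter_upwards [hne, eventually_mul_log_lt (c / 2 + κ)] with n ⟨hx, hy, _, h⟩ hκ z hxz hyz
    rw [Halves, abs_le] at hxz hyz
    rw [abs_le] at hx hy
    have hκ' : (c / 2 + κ) * Real.log n < e n * n := hκ
    have := h z (by linarith) (by linarith)
    simp only [g]
    linarith
  refine ⟨x, y, e, he, tendsto_one_div_sqrt_natCast_add_one, hne,
    isTheta_natCast_of_abs_sub_le_log two_ne_zero (hne.mono fun n h => h.1),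
    isTheta_natCast_of_abs_sub_le_log two_ne_zero (hne.mono fun n h => h.2.1),
    isTheta_natCast_of_abs_sub_le_log three_ne_zero hprof, ?_, fun κ => ?_, fun κ =>
    ⟨g, hg, ⟨1 / 4, by norm_num, ?_⟩, hup κ⟩⟩
  · refine IsBigO.of_bound (c / 2) ?_
    filter_upwards [hprof, eventually_ge_atTop 1] with n hn h1
    rw [Real.norm_of_nonneg (Real.log_nonneg (by exact_mod_cast h1)), Real.norm_eq_abs, abs_le]
    rw [abs_le] at hn
    constructor <;> linarith
  -- Halving the pair would leave at least `3n/2 - (c/2 + κ) log n > 5n/4` bits, but at most `n + g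
  -- n ≤ 5n/4` remain.
  · filter_upwards [hup κ, hprof, hgle, eventually_mul_log_lt (c / 2 + κ),
      tendsto_one_div_sqrt_natCast_add_one.eventually
        (gt_mem_nhds (show (0 : ℝ) < 1 / 4 by norm_num)),
      eventually_ge_atTop 1] with n hn hp hgn hκ hen h1
    rintro ⟨z, hxz, hyz, hz⟩
    have h2 := hn z hxz hyz
    rw [Halves, abs_le] at hz
    rw [abs_le] at hp
    have h1' : (1 : ℝ) ≤ n := by exact_mod_cast h1
    have h3 : 1 / √((n : ℝ) + 1) * n ≤ 1 / 4 * n :=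
      mul_le_mul_of_nonneg_right hen.le (by linarith)
    linarith
  · filter_upwards [hgle] with n hn
    linarith
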